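/- **Setting.** A server stores $N$ independent files $W_1,\dots,W_N$, each uniformly distributed on $\{0,1\}^F$, and is connected to $K$ users by an error-free multicast link. User $k$ has a cache of $\lfloor N m_kF\rfloor$ bits, where $m_k\in[0,1]$; write $\bm m=(m_1,\dots,m_K)$. A *caching scheme* consists of * placement functions: the cache content $Z_k$ of user $k$ is a function of $(W_1,\dots,W_N)$; * for each demand vector $\bm d\in[N]^K$ and each non-empty $\mathcal T\subseteq[K]$, a signal $X_{\mathcal T,\bm d}$ that is a function of $(W_{d_1},\dots,W_{d_K})$ and has $v_{\mathcal T}F$ bits, with $v_{\mathcal T}$ not depending on $\bm d$; * decoding functions: user $k$ computes an estimate $\hat W_{d_k}$ from $Z_k$ and all signals $X_{\mathcal T,\bm d}$. Its load is $\sum_{\mathcal T}v_{\mathcal T}$. A load $R$ is *achievable* (in a class of schemes) if for every $\epsilon>0$ and all sufficiently large $F$ there is a scheme (in the class) of load at most $R$ with $\max_{\bm d,k}\Pr(\hat W_{d_k}\ne W_{d_k})\le\epsilon$. Let $R^*(\bm m)$ be the infimum of the achievable loads over all schemes. Let $R^*_{\mathfrak A}(\bm m)$ be the infimum over schemes with *uncoded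 placement*: every file is partitioned into subfiles $\tilde W_{l,\mathcal S}$, $\mathcal S\subseteq[K]$, of $a_{\mathcal S}F$ bits, where $a_{\mathcal S}\in[0,1]$, $\sum_{\mathcal S}a_{\mathcal S}=1$ and $\sum_{\mathcal S\ni k}a_{\mathcal S}\le m_k$ for all $k$; the cache of user $k$ holds exactly the bits of the subfiles $\tilde W_{l,\mathcal S}$ with $k\in\mathcal S$, uncoded; the delivery is arbitrary. Let $R^*_{\mathfrak A,\mathfrak D}(\bm m)$ be the infimum over schemes with uncoded placement and *linear delivery*: $X_{\mathcal T,\bm d}=\bigoplus_{j\in\mathcal T}W^{\mathcal T}_{d_j}$, where $W^{\mathcal T}_{d_j}$ is a piece of $W_{d_j}$ with $v_{\mathcal T}F$ bits, all taken from subfiles $\tilde W_{d_j,\mathcal S}$ with $\mathcal T\setminus\{j\}\subseteq\mathcal S$ and $j\notin\mathcal S$, the number of bits taken from $\tilde W_{d_j,\mathcal S}$ depends only on $\mathcal T$ and $\mathcal S$, and for each $j$ the pieces $W^{\mathcal T}_{d_j}$, $\mathcal T\ni j$, are disjoint and together contain every bit of $W_{d_j}$ that is not cached by user $j$. **Theorem.**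 Let $1\le K\le N$, let $0\le m_1\le\dots\le m_K\le1$, and suppose that $\sum_{i=1}^K m_i\ge K-1$. Then $$R^*_{\mathfrak A}(\bm m)=R^*(\bm m)=1-m_1 .$$ Moreover $R^*_{\mathfrak A,\mathfrak D}(\bm m)=1-m_1$, so that uncoded placement with linear delivery is optimal among all caching schemes. -/

import Mathlib

open scoped BigOperators

namespace CodedCaching

/-- Strings of `n` bits; addition is bitwise XOR. -/
abbrev Bits (n : ℕ) : Type := Fin n → ZMod 2

/-- The non-empty sets of users, which index the unicast and multicast signals. -/
abbrev UserSet (K : ℕ) : Type := {T : Finset (Fin K) // T.Nonempty}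

/-- The number of bits in the cache of user `k`: the integer part of `M k * F`, where
`M k = N * m k` is the cache size in files and `m k` the cache size as a fraction of the library. -/
noncomputable def cacheSize (N F : ℕ) {K : ℕ} (m : Fin K → ℝ) (k : Fin K) : ℕ :=
  ⌊(N : ℝ) * m k * (F : ℝ)⌋₊

/-- A caching scheme for `K` users with normalized cache sizes `m` and a library of `N` files of
`F` bits each. -/
structure CachingScheme (N F : ℕ) {K : ℕ} (m : Fin K → ℝ) where
  /-- the content of each cache, as a function of the whole library -/
  place : (k : Fin K) → (Fin N → Bits F) → Bits (cacheSize N F m k)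
  /-- the length in bits of the signal for the set `T` of users, the same for all demands -/
  sigLen : UserSet K → ℕ
  /-- the signal for `T` under the demand vector `d`, as a function of the `K` requested files -/
  encode : (d : Fin K → Fin N) → (T : UserSet K) → (Fin K → Bits F) → Bits (sigLen T)
  /-- the file reconstructed by user `k` from all signals and its own cache -/
  decode : (d : Fin K → Fin N) → (k : Fin K) → ((T : UserSet K) → Bits (sigLen T)) →
    Bits (cacheSize N F m k) → Bits F

namespace CachingScheme

variable {N F K : ℕ} {m : Fin K → ℝ}

/-- The delivery load: the number of transmitted bits divided by the file size. -/
noncomputable def load (s : CachingScheme N F m) : ℝ :=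
  (∑ T : UserSet K, (s.sigLen T : ℝ)) / (F : ℝ)

/-- The file that user `k` reconstructs when the library is `W` and the demand vector is `d`. -/
def output (s : CachingScheme N F m) (d : Fin K → Fin N) (k : Fin K) (W : Fin N → Bits F) :
    Bits F :=
  s.decode d k (fun T => s.encode d T (fun j => W (d j))) (s.place k W)

/-- The probability that user `k` does not reconstruct its requested file under the demand vector
`d`, the files being independent and uniformly distributed. -/
noncomputable def errorProb (s : CachingScheme N F m) (d : Fin K → Fin N) (k : Fin K) : ℝ :=
  ((Finset.univ.filter fun W : Fin N → Bits F => s.output d k W ≠ W (d k)).card : ℝ) /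
    (Fintype.card (Fin N → Bits F) : ℝ)

end CachingScheme

/-- The allocation vectors of uncoded placement: `a S` is the fraction of every file that is stored
exclusively at the users in `S`. -/
def allocations {K : ℕ} (m : Fin K → ℝ) : Set (Finset (Fin K) → ℝ) :=
  {a | (∀ S, a S ∈ Set.Icc (0 : ℝ) 1) ∧ ∑ S, a S = 1 ∧
    ∀ k, ∑ S ∈ Finset.univ.filter (fun S : Finset (Fin K) => k ∈ S), a S ≤ m k}

/-- A partition of every file into subfiles: `P l i` is the set of the users that store bit `i` of
file `l`. The subfiles of the files have the sizes `a S * F` for one allocation vector `a`. -/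
def IsSubfilePartition {N F K : ℕ} (m : Fin K → ℝ) (P : Fin N → Fin F → Finset (Fin K)) : Prop :=
  ∃ a ∈ allocations m, ∀ (l : Fin N) (S : Finset (Fin K)),
    ((Finset.univ.filter fun i : Fin F => P l i = S).card : ℝ) = a S * (F : ℝ)

/-- The placement stores uncoded bits according to `P`: each cell of each cache holds a copy of one
bit of one file or is unused, and bit `i` of file `l` is held in the cache of user `k` if and only
if `k ∈ P l i`. -/
def StoresUncoded {N F K : ℕ} {m : Fin K → ℝ} (s : CachingScheme N F m)
    (P : Fin N → Fin F → Finset (Fin K)) : Prop :=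
  ∀ k : Fin K, ∃ cell : Fin (cacheSize N F m k) → Option (Fin N × Fin F),
    (∀ W q, s.place k W q = (cell q).elim 0 (fun p => W p.1 p.2)) ∧
    ∀ l i, k ∈ P l i ↔ ∃ q, cell q = some (l, i)

/-- Linear delivery for the subfile partition `P`: the signal for `T` is the XOR, over `j ∈ T`, of a
piece of the file requested by user `j`, and `piece d T j` lists the positions of the bits of that
piece. -/
def DeliversLinearly {N F K : ℕ} {m : Fin K → ℝ} (s : CachingScheme N F m)
    (P : Fin N → Fin F → Finset (Fin K)) : Prop :=
  ∃ (u : UserSet K → Finset (Fin K) → ℕ)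
    (piece : (Fin K → Fin N) → (T : UserSet K) → Fin K → Fin (s.sigLen T) → Fin F),
    -- the signals are XORs of pieces
    (∀ d T w i, s.encode d T w i = ∑ j ∈ T.1, w j (piece d T j i)) ∧
    -- the piece for `j` consists of distinct bits, which are cached by all the other users in `T`
    -- and not by `j`
    (∀ d T, ∀ j ∈ T.1, Function.Injective (piece d T j)) ∧
    (∀ d T, ∀ j ∈ T.1, ∀ i,
      T.1.erase j ⊆ P (d j) (piece d T j i) ∧ j ∉ P (d j) (piece d T j i)) ∧
    -- `u T S` bits of the piece come from the subfile stored exclusively at `S`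
    (∀ d T, ∀ j ∈ T.1, ∀ S, j ∉ S →
      (Finset.univ.filter fun i => P (d j) (piece d T j i) = S).card = u T S) ∧
    -- no bit is sent to the same user twice
    (∀ d T T' j, j ∈ T.1 → j ∈ T'.1 → T ≠ T' → ∀ i i', piece d T j i ≠ piece d T' j i') ∧
    -- every bit of a requested file that is missing in the cache of its user is delivered
    (∀ d j i, j ∉ P (d j) i → ∃ T : UserSet K, j ∈ T.1 ∧ ∃ i', piece d T j i' = i)

/-- All schemes: arbitrary placement and arbitrary delivery. -/
def allSchemes (N F : ℕ) {K : ℕ} (m : Fin K → ℝ) : Set (CachingScheme N F m) := Set.univ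

/-- The schemes with uncoded placement and arbitrary delivery. -/
def uncodedSchemes (N F : ℕ) {K : ℕ} (m : Fin K → ℝ) : Set (CachingScheme N F m) :=
  {s | ∃ P, IsSubfilePartition m P ∧ StoresUncoded s P}

/-- The schemes with uncoded placement and linear delivery. -/
def uncodedLinearSchemes (N F : ℕ) {K : ℕ} (m : Fin K → ℝ) : Set (CachingScheme N F m) :=
  {s | ∃ P, IsSubfilePartition m P ∧ StoresUncoded s P ∧ DeliversLinearly s P}

/-- The delivery loads that are achievable by schemes of the class `C`: for every `ε > 0` and every
large enough file size `F` there is a scheme in the class that transmits at most `R * F` bits and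
whose worst-case probability of error is at most `ε`. -/
def achievableLoads {N K : ℕ} {m : Fin K → ℝ} (C : (F : ℕ) → Set (CachingScheme N F m)) : Set ℝ :=
  {R | ∀ ε : ℝ, 0 < ε → ∃ F₀ : ℕ, ∀ F : ℕ, F₀ ≤ F →
    ∃ s ∈ C F, s.load ≤ R ∧ ∀ d k, s.errorProb d k ≤ ε}

end CodedCaching

/-! Converse: the cache of one user `k`, together with the signals for the `N` constant demand
vectors, determines essentially the whole library. Counting libraries gives `N F ≤ 1 + N m_k F + N R
F`, so `R ≥ 1 - m_k` in the limit of large `F` (`CachingScheme.card_bits_le`,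
`one_sub_le_of_mem_achievableLoads`); the smallest cache gives the strongest bound.

Achievability: `∑ m_k ≥ K - 1` means `∑ (1 - m_k) ≤ 1`. Every file therefore has room for disjoint
parts of sizes `(1 - m_k) F`, the `k`-th missing only at user `k`, with the rest stored everywhere.
Each user lacks only its own part of its requested file and knows the parts that the others lack, so
all these parts can be overlaid by XOR; the longest has `(1 - m_1) F` bits. Rounding leaves at most
one bit per file stored nowhere, which costs at most `K` further transmitted bits (`exists_sizes`,
`exists_uncodedLinear_scheme_of_sizes`). -/

namespace CodedCaching

open Finset

/-! ### Lower bound on the load by counting libraries. -/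

section Converse

variable {N F K : ℕ} {m : Fin K → ℝ}

/-- If user `k` reconstructs each file with error probability at most `1 / (2 N)`, then its cache
and the signals for the `N` constant demand vectors determine at least half of all libraries. -/
theorem CachingScheme.card_bits_le (s : CachingScheme N F m) (hN : 0 < N) (k : Fin K)
    (he : ∀ d, s.errorProb d k ≤ 1 / (2 * (N : ℝ))) :
    N * F ≤ 1 + (cacheSize N F m k + N * ∑ T, s.sigLen T) := by
  classical
  set bad : Fin N → Finset (Fin N → Bits F) := fun l =>
    univ.filter fun W => s.output (fun _ => l) k W ≠ W l with hbad
  set good : Finset (Fin N → Bits F) :=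
    univ.filter fun W => ∀ l, s.output (fun _ => l) k W = W l with hgood
  have hNR : (0 : ℝ) < N := by exact_mod_cast hN
  have htot : Fintype.card (Fin N → Bits F) = 2 ^ (N * F) := by
    simp [Fintype.card_pi, ZMod.card, ← pow_mul, mul_comm]
  have hbadcard : ∀ l, ((bad l).card : ℝ) ≤ 1 / (2 * (N : ℝ)) * 2 ^ (N * F) := by
    intro l
    have h := he (fun _ => l)
    unfold CachingScheme.errorProb at h
    rw [htot, div_le_iff₀ (by positivity)] at h
    simpa [hbad] using h
  have hcover : (univ : Finset (Fin N → Bits F)) ⊆ good ∪ univ.biUnion bad := by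
    intro W _
    by_cases h : ∀ l, s.output (fun _ => l) k W = W l
    · simp [hgood, h]
    · push Not at h
      obtain ⟨l, hl⟩ := h
      simp only [mem_union, mem_biUnion]
      exact Or.inr ⟨l, mem_univ _, by simpa [hbad] using hl⟩
  have hcount : 2 ^ (N * F) ≤ good.card + ∑ l, (bad l).card := by
    calc 2 ^ (N * F) = (univ : Finset (Fin N → Bits F)).card := by rw [card_univ, htot]
      _ ≤ (good ∪ univ.biUnion bad).card := card_le_card hcover
      _ ≤ good.card + (univ.biUnion bad).card := card_union_le _ _
      _ ≤ _ := Nat.add_le_add_left card_biUnion_le _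
  -- A union bound over the `N` constant demands: each spoils at most a fraction `1 / (2 N)` of the
  -- libraries.
  have hhalf : (2 : ℝ) ^ (N * F) ≤ 2 * good.card := by
    have h1 : (2 : ℝ) ^ (N * F) ≤ good.card + ∑ l, ((bad l).card : ℝ) := by exact_mod_cast hcount
    have h2 : ∑ l, ((bad l).card : ℝ) ≤ 2 ^ (N * F) / 2 := by
      calc ∑ l, ((bad l).card : ℝ) ≤ ∑ _l : Fin N, 1 / (2 * (N : ℝ)) * 2 ^ (N * F) :=
            sum_le_sum fun l _ => hbadcard l
        _ = 2 ^ (N * F) / 2 := by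
            rw [sum_const, card_univ, Fintype.card_fin, nsmul_eq_mul]
            field_simp
    linarith
  have hhalf' : 2 ^ (N * F) ≤ 2 * good.card := by exact_mod_cast hhalf
  -- Under the constant demand `l` the signals see only `W l`. On `good` the decoder of user `k`
  -- recovers every file from these data.
  let obs : (Fin N → Bits F) →
      Bits (cacheSize N F m k) × (Fin N → (T : UserSet K) → Bits (s.sigLen T)) :=
    fun W => (s.place k W, fun l T => s.encode (fun _ => l) T (fun _ => W l))
  have hinj : Set.InjOn obs good := by
    intro W hW W' hW' h
    simp only [hgood, coe_filter, mem_univ, true_and, Set.mem_ofPred_eq] at hW hW'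
    funext l
    rw [← hW l, ← hW' l]
    simp only [obs, Prod.mk.injEq] at h
    unfold CachingScheme.output
    rw [h.1, congrFun h.2 l]
  have hcard : good.card ≤ 2 ^ (cacheSize N F m k + N * ∑ T, s.sigLen T) := by
    have h := card_le_card_of_injOn (t := univ) obs (fun _ _ => mem_univ _) hinj
    refine h.trans (le_of_eq ?_)
    rw [card_univ, Fintype.card_prod]
    simp only [Fintype.card_pi, ZMod.card, prod_const, card_univ, Fintype.card_fin,
      prod_pow_eq_pow_sum]
    rw [← pow_mul, ← pow_add, mul_comm N]
  have : 2 ^ (N * F) ≤ 2 ^ (1 + (cacheSize N F m k + N * ∑ T, s.sigLen T)) := by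
    rw [pow_add 2 1, pow_one]
    exact hhalf'.trans (Nat.mul_le_mul_left 2 hcard)
  exact (Nat.pow_le_pow_iff_right (by norm_num)).1 this

/-- No load below `1 - m k` is achievable. -/
theorem one_sub_le_of_mem_achievableLoads (hN : 0 < N) (k : Fin K) (hm : 0 ≤ m k) {R : ℝ}
    (hR : R ∈ achievableLoads fun F => allSchemes N F m) : 1 - m k ≤ R := by
  by_contra! hlt
  have hNR : (1 : ℝ) ≤ N := by exact_mod_cast hN
  obtain ⟨F₀, hF₀⟩ := hR (1 / (2 * (N : ℝ))) (by positivity)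
  -- Beyond this file size the gap `(1 - m k - R) * F` exceeds the single bit of slack in the
  -- counting bound.
  obtain ⟨n, hn⟩ := exists_nat_gt (1 / (1 - m k - R))
  have hpos : 0 < 1 - m k - R := by linarith
  set F := max F₀ (n + 1)
  obtain ⟨s, -, hload, herr⟩ := hF₀ F (le_max_left _ _)
  have hFn : (n : ℝ) + 1 ≤ F := by exact_mod_cast le_max_right F₀ (n + 1)
  have hFpos : (0 : ℝ) < F := by
    have : (0 : ℝ) ≤ n := n.cast_nonneg
    linarith
  have hb : (N : ℝ) * F ≤ 1 + (cacheSize N F m k + N * ∑ T, (s.sigLen T : ℝ)) := by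
    exact_mod_cast s.card_bits_le hN k (fun d => herr d k)
  have hc : (cacheSize N F m k : ℝ) ≤ N * m k * F := Nat.floor_le (mul_nonneg (mul_nonneg N.cast_nonneg hm) F.cast_nonneg)
  have hl : ∑ T, (s.sigLen T : ℝ) ≤ R * F := by
    unfold CachingScheme.load at hload
    rwa [div_le_iff₀ hFpos] at hload
  have hl' := mul_le_mul_of_nonneg_left hl (by linarith : (0 : ℝ) ≤ N)
  have h1 : (N : ℝ) * (F * (1 - m k - R)) ≤ 1 := by nlinarith
  have h2 : 1 < F * (1 - m k - R) := by
    rw [div_lt_iff₀ hpos] at hn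
    nlinarith
  nlinarith

end Converse

/-! ### From a combinatorial design to a zero-error scheme with linear delivery. -/

section Assembly

/-- A finite set with at most `n` elements can be listed in `n` cells, some of them unused. -/
theorem exists_cells {α : Type*} (s : Finset α) {n : ℕ} (hs : s.card ≤ n) :
    ∃ cell : Fin n → Option α, ∀ a, a ∈ s ↔ ∃ q, cell q = some a := by
  refine ⟨fun q => s.toList[(q : ℕ)]?, fun a => ?_⟩
  rw [← mem_toList, List.mem_iff_getElem?]
  constructor
  · rintro ⟨i, hi⟩
    have hlt : i < s.card := by
      obtain ⟨h, -⟩ := List.getElem?_eq_some_iff.1 hi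
      simpa using h
    exact ⟨⟨i, hlt.trans_le hs⟩, hi⟩
  · rintro ⟨q, hq⟩
    exact ⟨q, hq⟩

variable {F K : ℕ} {m : Fin K → ℝ}

/-- The same partition of every file is a subfile partition if user `k` stores at most `m k * F`
bits of it. -/
theorem isSubfilePartition_const (N : ℕ) (hF : 0 < F)
    (P : Fin F → Finset (Fin K))
    (hcache : ∀ k, ((univ.filter fun i => k ∈ P i).card : ℝ) ≤ m k * F) :
    IsSubfilePartition (N := N) m (fun _ => P) := by
  have hFR : (0 : ℝ) < F := by exact_mod_cast hF
  refine ⟨fun S => ((univ.filter fun i => P i = S).card : ℝ) / F,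
    ⟨fun S => ⟨by positivity, ?_⟩, ?_, fun k => ?_⟩, fun _ S => ?_⟩
  · rw [div_le_one hFR]
    exact_mod_cast (card_le_univ _).trans_eq (Fintype.card_fin F)
  · rw [← sum_div, div_eq_one_iff_eq hFR.ne', ← Nat.cast_sum]
    have := card_eq_sum_card_fiberwise (s := (univ : Finset (Fin F))) (t := univ) (f := P)
      (fun _ _ => mem_univ _)
    rw [← this, card_univ, Fintype.card_fin]
  · rw [← sum_div, div_le_iff₀ hFR]
    refine le_of_eq_of_le ?_ (hcache k)
    rw [← Nat.cast_sum]
    have := card_eq_sum_card_fiberwise (s := univ.filter fun i => k ∈ P i)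
      (t := univ.filter fun S : Finset (Fin K) => k ∈ S) (f := P) (fun i hi => by simpa using hi)
    rw [this]
    congr 1
    refine sum_congr rfl fun S hS => ?_
    rw [filter_filter]
    congr 1
    ext i
    simp only [mem_filter, mem_univ, true_and] at hS ⊢
    exact ⟨fun h => ⟨h ▸ hS, h⟩, fun h => h.2⟩
  · field_simp

/-- A combinatorial design for linear delivery: `P i` is the set of users storing bit `i` of every
file, and bit `i` is delivered to a user `j` missing it by the signal for `τ j i`. If for all users
in `T` the signal for `T` delivers the same number of bits from each subfile, the design gives a
scheme without errors. -/
theorem exists_uncodedLinear_scheme (N : ℕ) (hF : 0 < F)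
    (P : Fin F → Finset (Fin K)) (τ : Fin K → Fin F → UserSet K)
    (v : UserSet K → ℕ) (u : UserSet K → Finset (Fin K) → ℕ)
    (hcache : ∀ k, ((univ.filter fun i => k ∈ P i).card : ℝ) ≤ m k * F)
    (hmem : ∀ j i, j ∉ P i → j ∈ (τ j i).1)
    (hsub : ∀ j i, j ∉ P i → (τ j i).1.erase j ⊆ P i)
    (hv : ∀ T : UserSet K, ∀ j ∈ T.1,
      (univ.filter fun i => j ∉ P i ∧ τ j i = T).card = v T)
    (hu : ∀ T : UserSet K, ∀ j ∈ T.1, ∀ S, j ∉ S →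
      (univ.filter fun i => (j ∉ P i ∧ τ j i = T) ∧ P i = S).card = u T S) :
    ∃ s ∈ uncodedLinearSchemes N F m, s.sigLen = v ∧ ∀ d k, s.errorProb d k = 0 := by
  classical
  have hcells : ∀ k : Fin K, ∃ cell : Fin (cacheSize N F m k) → Option (Fin N × Fin F),
      ∀ l i, k ∈ P i ↔ ∃ q, cell q = some (l, i) := by
    intro k
    have hcard : (univ ×ˢ univ.filter fun i => k ∈ P i : Finset (Fin N × Fin F)).card ≤
        cacheSize N F m k := by
      rw [card_product, card_univ, Fintype.card_fin]
      refine Nat.le_floor ?_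
      push_cast
      rw [mul_assoc]
      exact mul_le_mul_of_nonneg_left (hcache k) N.cast_nonneg
    obtain ⟨cell, hcell⟩ := exists_cells _ hcard
    exact ⟨cell, fun l i => by rw [← hcell]; simp⟩
  choose cell hcell using hcells
  have hpieces : ∀ (T : UserSet K) (j : Fin K), ∃ p : Fin (v T) → Fin F, j ∈ T.1 →
      Function.Injective p ∧ ∀ i, (∃ q, p q = i) ↔ j ∉ P i ∧ τ j i = T := by
    intro T j
    by_cases hj : j ∈ T.1
    · let e := (univ.filter fun i => j ∉ P i ∧ τ j i = T).orderEmbOfFin (hv T j hj)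
      refine ⟨e, fun _ => ⟨e.injective, fun i => ?_⟩⟩
      have := range_orderEmbOfFin (univ.filter fun i => j ∉ P i ∧ τ j i = T) (hv T j hj)
      have hi : i ∈ Set.range e ↔ i ∈ (univ.filter fun i => j ∉ P i ∧ τ j i = T) := by
        rw [this, mem_coe]
      simpa using hi
    · exact ⟨fun _ => ⟨0, hF⟩, fun h => absurd h hj⟩
  choose piece hpiece using hpieces
  have hpieceP : ∀ (T : UserSet K) (j : Fin K), j ∈ T.1 → ∀ q,
      j ∉ P (piece T j q) ∧ τ j (piece T j q) = T := fun T j hj q =>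
    ((hpiece T j hj).2 _).1 ⟨q, rfl⟩
  let place : (k : Fin K) → (Fin N → Bits F) → Bits (cacheSize N F m k) :=
    fun k W q => (cell k q).elim 0 (fun p => W p.1 p.2)
  let encode : (d : Fin K → Fin N) → (T : UserSet K) → (Fin K → Bits F) → Bits (v T) :=
    fun _ T w i => ∑ j ∈ T.1, w j (piece T j i)
  have hplace : ∀ k W W', place k W = place k W' → ∀ l i, k ∈ P i → W l i = W' l i := by
    intro k W W' h l i hk
    obtain ⟨q, hq⟩ := (hcell k l i).1 hk
    have := congrFun h q
    simpa [place, hq] using this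
  -- A missing bit of user `k` is one summand of a signal bit; `hsub` puts all other summands in the
  -- cache of `k`, so they cancel.
  have hdet : ∀ (d : Fin K → Fin N) k W W',
      (fun T => encode d T fun j => W (d j)) = (fun T => encode d T fun j => W' (d j)) →
      place k W = place k W' → W (d k) = W' (d k) := by
    intro d k W W' hX hZ
    funext i
    by_cases hk : k ∈ P i
    · exact hplace k W W' hZ _ _ hk
    · have hkT := hmem k i hk
      obtain ⟨q, hq⟩ := ((hpiece (τ k i) k hkT).2 i).2 ⟨hk, rfl⟩
      have h := congrFun (congrFun hX (τ k i)) q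
      simp only [encode] at h
      rw [← add_sum_erase _ _ hkT, ← add_sum_erase _ _ hkT, hq] at h
      have hrest : ∑ j ∈ (τ k i).1.erase k, W (d j) (piece (τ k i) j q) =
          ∑ j ∈ (τ k i).1.erase k, W' (d j) (piece (τ k i) j q) := by
        refine sum_congr rfl fun j hj => hplace k W W' hZ _ _ ?_
        have hj' := mem_erase.1 hj
        have hp := hpieceP (τ k i) j hj'.2 q
        refine hsub j _ hp.1 ?_
        rw [hp.2]
        exact mem_erase.2 ⟨hj'.1.symm, hkT⟩
      rw [hrest] at h
      exact add_right_cancel h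
  let s : CachingScheme N F m :=
    { place := place
      sigLen := v
      encode := encode
      -- The decoder picks any library consistent with what user `k` sees; by `hdet` they all agree
      -- on the requested file.
      decode := fun d k X Z =>
        if h : ∃ W, (fun T => encode d T fun j => W (d j)) = X ∧ place k W = Z then
          h.choose (d k) else 0 }
  have hout : ∀ d k W, s.output d k W = W (d k) := by
    intro d k W
    have h : ∃ W', (fun T => encode d T fun j => W' (d j)) =
        (fun T => encode d T fun j => W (d j)) ∧ place k W' = place k W := ⟨W, rfl, rfl⟩
    have hs : s.output d k W = h.choose (d k) := dif_pos h
    rw [hs]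
    exact hdet d k _ _ h.choose_spec.1 h.choose_spec.2
  refine ⟨s, ⟨fun _ => P, isSubfilePartition_const N hF P hcache,
    fun k => ⟨cell k, fun _ _ => rfl, hcell k⟩, u, fun _ => piece, fun _ _ _ _ => rfl,
    fun _ T j hj => (hpiece T j hj).1, fun _ T j hj i => ?_, fun _ T j hj S hS => ?_,
    fun _ T T' j hj hj' hne i i' h => ?_, fun _ j i hji => ?_⟩, rfl, fun d k => ?_⟩
  · have hp := hpieceP T j hj i
    refine ⟨?_, hp.1⟩
    have := hsub j _ hp.1
    rwa [hp.2] at this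
  · rw [← hu T j hj S hS, ← card_image_of_injective _ (hpiece T j hj).1]
    congr 1
    ext i
    simp only [mem_image, mem_filter, mem_univ, true_and]
    constructor
    · rintro ⟨q, hq, rfl⟩
      exact ⟨hpieceP T j hj q, hq⟩
    · rintro ⟨hi, hS⟩
      obtain ⟨q, rfl⟩ := ((hpiece T j hj).2 i).2 hi
      exact ⟨q, hS, rfl⟩
  · have h1 := (hpieceP T j hj i).2
    have h2 := (hpieceP T' j hj' i').2
    exact hne (h1.symm.trans ((congrArg (τ j) h).trans h2))
  · exact ⟨τ j i, hmem j i hji, ((hpiece _ j (hmem j i hji)).2 i).2 ⟨hji, rfl⟩⟩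
  · simp [CachingScheme.errorProb, hout]

end Assembly

/-! ### The design with parts missing at single users, and its signal lengths. -/

section Design

variable {K : ℕ}

/-- The bits of a file: `n j` bits missing only at user `j`, `e` bits stored nowhere and `c` bits
stored everywhere. -/
abbrev Bit (n : Fin K → ℕ) (e c : ℕ) : Type := (Σ j, Fin (n j)) ⊕ (Fin e ⊕ Fin c)

/-- The users storing a bit. -/
def Bit.storedAt {n : Fin K → ℕ} {e c : ℕ} : Bit n e c → Finset (Fin K)
  | .inl x => univ.erase x.1
  | .inr (.inl _) => ∅
  | .inr (.inr _) => univ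

/-- The users missing more than `r` of the bits stored at all other users. -/
def level (n : Fin K → ℕ) (r : ℕ) : Finset (Fin K) := univ.filter fun j => r < n j

/-- The signal delivering a bit to user `j`: the `r`-th bits missing at single users are sent
together, and the bits stored nowhere are sent to each user separately. -/
def Bit.signal {n : Fin K → ℕ} {e c : ℕ} (j : Fin K) : Bit n e c → UserSet K
  | .inl x => ⟨level n x.2, x.1, by simp [level]⟩
  | .inr _ => ⟨{j}, singleton_nonempty j⟩

/-- The number of levels at which exactly the users in `T` miss a bit. -/
def levelCount (n : Fin K → ℕ) (B : ℕ) (T : Finset (Fin K)) : ℕ :=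
  ((range B).filter fun r => level n r = T).card

/-- A level set containing `j` can only occur at some `r < n j`, so no level is lost by restricting
to the bits of `j`. Hence the count is the same for all `j ∈ T`. -/
theorem card_level_bits {n : Fin K → ℕ} {B : ℕ} (hB : ∀ j, n j ≤ B) {T : Finset (Fin K)}
    {j : Fin K} (hj : j ∈ T) :
    (univ.filter fun r : Fin (n j) => level n r = T).card = levelCount n B T := by
  refine card_bij (fun r _ => (r : ℕ)) ?_ ?_ ?_
  · intro r hr
    simpa [r.2.trans_le (hB j)] using hr
  · intro a _ b _ h
    exact Fin.ext h
  · intro r hr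
    simp only [mem_filter, mem_range] at hr
    have : r < n j := by
      rw [← hr.2] at hj
      simpa [level] using hj
    exact ⟨⟨r, this⟩, by simpa using hr.2, rfl⟩

/-- Counting bits separately over the three kinds. -/
theorem card_filter_bit {n : Fin K → ℕ} {e c : ℕ} (p : Bit n e c → Prop) [DecidablePred p] :
    (univ.filter p).card = ∑ j, (univ.filter fun r : Fin (n j) => p (.inl ⟨j, r⟩)).card +
      ((univ.filter fun r : Fin e => p (.inr (.inl r))).card +
        (univ.filter fun r : Fin c => p (.inr (.inr r))).card) := by
  simp only [card_filter, Fintype.sum_sum_type, Fintype.sum_sigma]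

/-- User `j` misses bits of two kinds only, stored at `univ.erase j` or nowhere. The predicate `Q`
lets one count serve both for the signal lengths (`Q` always true) and for the contribution of a
single subfile. -/
theorem card_signal_bits {n : Fin K → ℕ} {e c B : ℕ} (hB : ∀ j, n j ≤ B) (T : UserSet K)
    {j : Fin K} (hj : j ∈ T.1) (Q : Finset (Fin K) → Prop) [DecidablePred Q] :
    (univ.filter fun b : Bit n e c =>
      (j ∉ b.storedAt ∧ b.signal j = T) ∧ Q b.storedAt).card =
      (if Q (univ.erase j) then levelCount n B T.1 else 0) +
        (if Q ∅ ∧ T.1.card = 1 then e else 0) := by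
  rw [card_filter_bit, sum_eq_single j]
  · have hs : ({j} : Finset (Fin K)) = T.1 ↔ T.1.card = 1 := by
      constructor
      · intro h; rw [← h, card_singleton]
      · intro h
        obtain ⟨a, ha⟩ := card_eq_one.1 h
        rw [ha] at hj ⊢
        rw [mem_singleton.1 hj]
    rw [← card_level_bits hB hj]
    congr 1
    · by_cases hQ : Q (univ.erase j) <;> simp [Bit.storedAt, Bit.signal, Subtype.ext_iff, hQ]
    · by_cases hQ : Q ∅ <;> by_cases hT : T.1.card = 1 <;>
        simp [Bit.storedAt, Bit.signal, Subtype.ext_iff, hs, hQ, hT]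
  · intro k _ hk
    simp [Bit.storedAt, hk.symm]
  · simp

theorem card_storedAt {n : Fin K → ℕ} {e c : ℕ} (k : Fin K) :
    (univ.filter fun b : Bit n e c => k ∈ b.storedAt).card + n k = ∑ j, n j + c := by
  rw [card_filter_bit, ← add_sum_erase _ _ (mem_univ k), ← add_sum_erase univ n (mem_univ k)]
  have : ∑ j ∈ univ.erase k, (univ.filter fun r : Fin (n j) =>
      k ∈ Bit.storedAt (e := e) (c := c) (.inl ⟨j, r⟩)).card = ∑ j ∈ univ.erase k, n j := by
    refine sum_congr rfl fun j hj => ?_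
    simp [Bit.storedAt, (mem_erase.1 hj).1.symm]
  rw [this]
  simp [Bit.storedAt]
  ring

/-- Each `r < B` has exactly one level set; levels with empty level set need no signal, hence an
inequality. -/
theorem sum_levelCount_le {n : Fin K → ℕ} {B : ℕ} :
    ∑ T : UserSet K, levelCount n B T.1 ≤ B := by
  calc ∑ T : UserSet K, levelCount n B T.1
      ≤ ∑ T : Finset (Fin K), levelCount n B T := by
        refine (sum_map univ (Function.Embedding.subtype _) (levelCount n B)).symm.trans_le ?_
        exact sum_le_sum_of_subset (subset_univ _)
    _ = B := by
        have := card_eq_sum_card_fiberwise (s := range B) (t := univ) (f := level n)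
          (fun _ _ => mem_univ _)
        rw [card_range] at this
        exact this.symm

theorem card_singleton_userSets :
    (univ.filter fun T : UserSet K => T.1.card = 1).card ≤ K := by
  calc (univ.filter fun T : UserSet K => T.1.card = 1).card
      ≤ (univ.image fun j : Fin K => (⟨{j}, singleton_nonempty j⟩ : UserSet K)).card := by
        refine card_le_card fun T hT => ?_
        obtain ⟨a, ha⟩ := card_eq_one.1 (mem_filter.1 hT).2
        exact mem_image.2 ⟨a, mem_univ _, Subtype.ext ha.symm⟩
    _ ≤ K := card_image_le.trans_eq (by simp)

/-- If every file splits into `n j` bits missing only at user `j`, `e` bits stored nowhere and `c`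
bits stored everywhere, then `B + K * e` transmitted bits suffice, where `B` bounds all `n j`. -/
theorem exists_uncodedLinear_scheme_of_sizes (N : ℕ) {F : ℕ} {m : Fin K → ℝ} (hF : 0 < F)
    (n : Fin K → ℕ) (e c B : ℕ)
    (hsize : ∑ j, n j + e + c = F) (hB : ∀ j, n j ≤ B)
    (hcache : ∀ k, (1 - m k) * F ≤ n k + e) :
    ∃ s ∈ uncodedLinearSchemes N F m, ∑ T, s.sigLen T ≤ B + K * e ∧
      ∀ d k, s.errorProb d k = 0 := by
  have hcard : Fintype.card (Fin F) = Fintype.card (Bit n e c) := by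
    simp [← hsize, add_assoc]
  let φ : Fin F ≃ Bit n e c := Fintype.equivOfCardEq hcard
  have hφ : ∀ (p : Bit n e c → Prop) [DecidablePred p],
      (univ.filter fun i => p (φ i)).card = (univ.filter p).card := fun p _ =>
    card_equiv φ (by simp)
  suffices h : ∃ s ∈ uncodedLinearSchemes N F m,
      (s.sigLen = fun T => levelCount n B T.1 + if T.1.card = 1 then e else 0) ∧
      ∀ d k, s.errorProb d k = 0 by
    obtain ⟨s, hs, hlen, herr⟩ := h
    refine ⟨s, hs, ?_, herr⟩
    rw [hlen, sum_add_distrib, ← sum_filter, sum_const, smul_eq_mul]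
    exact add_le_add sum_levelCount_le (Nat.mul_le_mul_right e card_singleton_userSets)
  refine exists_uncodedLinear_scheme N hF
    (fun i => (φ i).storedAt) (fun j i => (φ i).signal j) _
    -- The two terms are added, not split into cases: for `K = 1` both `univ.erase j` and `∅` are
    -- the same subfile.
    (fun T S => (if ∃ j ∈ T.1, S = univ.erase j then levelCount n B T.1 else 0) +
      if S = ∅ ∧ T.1.card = 1 then e else 0)
    (fun k => ?_) (fun j i => ?_) (fun j i => ?_) (fun T j hj => ?_) (fun T j hj S hS => ?_)
  · rw [hφ fun b => k ∈ b.storedAt]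
    have h1 : ((univ.filter fun b : Bit n e c => k ∈ b.storedAt).card : ℝ) + n k =
        ∑ j, (n j : ℝ) + c := by exact_mod_cast card_storedAt k
    have h2 : ∑ j, (n j : ℝ) + e + c = F := by exact_mod_cast hsize
    linarith [hcache k]
  · rcases φ i with ⟨k, r⟩ | r | r
    · intro h
      have : j = k := by simpa [Bit.storedAt] using h
      subst this
      simp [Bit.signal, level]
    · simp [Bit.signal]
    · simp [Bit.storedAt]
  · rcases φ i with ⟨k, r⟩ | r | r
    · intro h
      have : j = k := by simpa [Bit.storedAt] using h
      subst this
      exact erase_subset_erase _ (subset_univ _)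
    · simp [Bit.signal]
    · simp [Bit.storedAt]
  · rw [hφ fun b => j ∉ b.storedAt ∧ b.signal j = T]
    have := card_signal_bits (e := e) (c := c) hB T hj (fun _ => True)
    simpa using this
  · rw [hφ fun b => (j ∉ b.storedAt ∧ b.signal j = T) ∧ b.storedAt = S,
      card_signal_bits hB T hj (fun S' => S' = S)]
    have h1 : univ.erase j = S ↔ ∃ j ∈ T.1, S = univ.erase j := by
      constructor
      · exact fun h => ⟨j, hj, h.symm⟩
      · rintro ⟨k, -, rfl⟩
        have : j = k := by simpa using hS
        rw [this]
    simp only [h1, eq_comm (a := (∅ : Finset (Fin K)))]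

end Design

/-! ### Rounding to whole bits and passage to large file sizes. -/

section Achievability

variable {K : ℕ} {m : Fin K → ℝ}

/-- Rounding the sizes of the subfiles: at most one bit per file is stored nowhere. -/
theorem exists_sizes (hm : ∀ k, m k ≤ 1) (hsum : (K : ℝ) - 1 ≤ ∑ k, m k) (F : ℕ) :
    ∃ (n : Fin K → ℕ) (e c : ℕ), ∑ j, n j + e + c = F ∧ e ≤ 1 ∧
      (∀ k, (n k : ℝ) ≤ (1 - m k) * F) ∧ ∀ k, (1 - m k) * F ≤ n k + e := by
  have hnn : ∀ k, 0 ≤ (1 - m k) * (F : ℝ) := fun k =>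
    mul_nonneg (sub_nonneg.2 (hm k)) F.cast_nonneg
  let n : Fin K → ℕ := fun k => ⌊(1 - m k) * (F : ℝ)⌋₊
  have hn : ∀ k, (n k : ℝ) ≤ (1 - m k) * F := fun k => Nat.floor_le (hnn k)
  have htot : ∑ k, (1 - m k) * (F : ℝ) ≤ F := by
    rw [← sum_mul, sum_sub_distrib]
    simp only [sum_const, card_univ, Fintype.card_fin, nsmul_eq_mul, mul_one]
    nlinarith [F.cast_nonneg (α := ℝ)]
  have hle : ∑ k, n k ≤ F := by
    have : ∑ k, (n k : ℝ) ≤ F := (sum_le_sum fun k _ => hn k).trans htot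
    exact_mod_cast this
  -- If the floors already sum to `F`, nothing was rounded down. Otherwise one bit is free, and
  -- storing it nowhere makes up for the rounding loss, below one bit, of every user at once.
  rcases hle.eq_or_lt with heq | hlt
  · refine ⟨n, 0, 0, by simpa using heq, zero_le_one, hn, fun k => ?_⟩
    have heq' : ∑ k, (n k : ℝ) = F := by exact_mod_cast heq
    have hs : ∑ k, (n k : ℝ) = ∑ k, (1 - m k) * (F : ℝ) :=
      le_antisymm (sum_le_sum fun k _ => hn k) (htot.trans_eq heq'.symm)
    have := (sum_eq_sum_iff_of_le fun k _ => hn k).1 hs k (mem_univ k)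
    simp [this]
  · refine ⟨n, 1, F - ∑ k, n k - 1, by omega, le_rfl, hn, fun k => ?_⟩
    push_cast
    exact (Nat.lt_floor_add_one _).le

/-- Every load above `1 - m k`, where `k` has the smallest cache, is achievable by uncoded placement
with linear delivery. -/
theorem mem_achievableLoads_uncodedLinearSchemes (N : ℕ) (k : Fin K)
    (hm : ∀ j, m j ∈ Set.Icc (0 : ℝ) 1) (hk : ∀ j, m k ≤ m j)
    (hsum : (K : ℝ) - 1 ≤ ∑ j, m j) {R : ℝ} (hR : 1 - m k < R) :
    R ∈ achievableLoads fun F => uncodedLinearSchemes N F m := by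
  intro ε hε
  have hpos : 0 < R - (1 - m k) := by linarith
  -- For such `F` the excess of `R` over `1 - m k` pays for the at most `K` bits sent because of
  -- rounding.
  obtain ⟨F₀, hF₀⟩ := exists_nat_gt ((K : ℝ) / (R - (1 - m k)))
  refine ⟨F₀ + 1, fun F hF => ?_⟩
  have hFR : (F₀ : ℝ) + 1 ≤ F := by exact_mod_cast hF
  have hFpos : (0 : ℝ) < F := by
    have : (0 : ℝ) ≤ F₀ := F₀.cast_nonneg
    linarith
  obtain ⟨n, e, c, hsize, he, hn, hcache⟩ := exists_sizes (fun j => (hm j).2) hsum F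
  have hB : ∀ j, n j ≤ ⌊(1 - m k) * (F : ℝ)⌋₊ := fun j =>
    Nat.le_floor ((hn j).trans (by nlinarith [hk j]))
  obtain ⟨s, hs, hlen, herr⟩ := exists_uncodedLinear_scheme_of_sizes N (by omega) n e c _
    hsize hB hcache
  refine ⟨s, hs, ?_, fun d j => (herr d j).trans_le hε.le⟩
  have h1 : ∑ T, (s.sigLen T : ℝ) ≤ ⌊(1 - m k) * (F : ℝ)⌋₊ + K * (e : ℝ) := by
    exact_mod_cast hlen
  have h2 : ((⌊(1 - m k) * (F : ℝ)⌋₊ : ℕ) : ℝ) ≤ (1 - m k) * F :=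
    Nat.floor_le (mul_nonneg (sub_nonneg.2 (hm k).2) hFpos.le)
  have h3 : (K : ℝ) * e ≤ K := by
    have : (e : ℝ) ≤ 1 := by exact_mod_cast he
    exact mul_le_of_le_one_right K.cast_nonneg this
  have h4 : (K : ℝ) ≤ (R - (1 - m k)) * F := by
    rw [div_lt_iff₀ hpos] at hF₀
    nlinarith
  rw [CachingScheme.load, div_le_iff₀ hFpos]
  linarith

end Achievability

theorem achievableLoads_mono {N K : ℕ} {m : Fin K → ℝ} {C C' : (F : ℕ) → Set (CachingScheme N F m)}
    (h : ∀ F, C F ⊆ C' F) : achievableLoads C ⊆ achievableLoads C' := by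
  intro R hR ε hε
  obtain ⟨F₀, hF₀⟩ := hR ε hε
  refine ⟨F₀, fun F hF => ?_⟩
  obtain ⟨s, hs, hrest⟩ := hF₀ F hF
  exact ⟨s, h F hs, hrest⟩

end CodedCaching

theorem mainTheorem4 (K N : ℕ) (hK : 0 < K) (hKN : K ≤ N) (m : Fin K → ℝ)
    (hm : ∀ k, m k ∈ Set.Icc (0 : ℝ) 1) (hmono : Monotone m)
    (hsum : (K : ℝ) - 1 ≤ ∑ k, m k) :
    IsGLB (CodedCaching.achievableLoads fun F => CodedCaching.uncodedSchemes N F m)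
        (1 - m ⟨0, hK⟩) ∧
      IsGLB (CodedCaching.achievableLoads fun F => CodedCaching.allSchemes N F m)
        (1 - m ⟨0, hK⟩) ∧
      IsGLB (CodedCaching.achievableLoads fun F => CodedCaching.uncodedLinearSchemes N F m)
        (1 - m ⟨0, hK⟩) := by
  -- All three classes lie between the linear uncoded schemes and all schemes, so achievability in
  -- the smallest class and the converse in the largest settle them together.
  have key : ∀ C : (F : ℕ) → Set (CodedCaching.CachingScheme N F m),
      (∀ F, CodedCaching.uncodedLinearSchemes N F m ⊆ C F) →
      IsGLB (CodedCaching.achievableLoads C) (1 - m ⟨0, hK⟩) := by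
    intro C hC
    refine ⟨fun R hR => ?_, fun b hb => le_of_forall_gt_imp_ge_of_dense fun R hR => hb ?_⟩
    · exact CodedCaching.one_sub_le_of_mem_achievableLoads (hK.trans_le hKN) _ (hm _).1
        (CodedCaching.achievableLoads_mono (fun _ => Set.subset_univ _) hR)
    · exact CodedCaching.achievableLoads_mono hC
        (CodedCaching.mem_achievableLoads_uncodedLinearSchemes N ⟨0, hK⟩ hm
          (fun j => hmono (Nat.zero_le _)) hsum hR)
  exact ⟨key _ fun _ _ ⟨P, hP, hs, _⟩ => ⟨P, hP, hs⟩, key _ fun _ => Set.subset_univ _,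
    key _ fun _ => subset_rfl⟩
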